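/- Let $E$ be a real Banach space, let $T\colon\ell^1\to E$ be a continuous linear operator on the space of absolutely summable real sequences, let $e_n=\chi_{\{n\}}$ be the unit vectors, and assume $T(e_n)\neq 0$ for all $n\in\mathbb{N}$. Let $1<p<\infty$. Let $m_T\colon\mathcal{P}_F(\mathbb{N})\to E$, $m_T(A)=T(\chi_A)$, be the associated vector measure on the $\delta$-ring $\mathcal{P}_F(\mathbb{N})$ of finite subsets of $\mathbb{N}$. For $x^*\in E^*$ let $|x^*m_T|$ be the variation of the real measure $x^*m_T$, that is, $|x^*m_T|(A)=\sup\sum_j|x^*m_T(A_j)|$, where the supremum is over all finite disjoint families of finite sets $A_j\subset A$. For $f\in L^1(|x^*m_T|)$ and $A\subset\mathbb{N}$ put $\int_A f\,dx^*m_T=\lim_n\int_A\varphi_n\,dx^*m_T$, where $(\varphi_n)$ is any sequence of finitely supported functions converging to $f$ in $L^1(|x^*m_T|)$ and $\int_A\varphi\,dx^*m_T=\sum_j\alpha_j\,x^*m_T(A_j\cap A)$ for $\varphi=\sum_j\alpha_j\chi_{A_j}$ (a finite sum with $A_j$ finite). Let $\ell^1(m_T)$ be the space of all real sequences $f$ such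 that (i) $f\in L^1(|x^*m_T|)$ for every $x^*\in E^*$, and (ii) for every $A\subset\mathbb{N}$ there is $x_A\in E$ with $x^*(x_A)=\int_A f\,dx^*m_T$ for every $x^*\in E^*$. For $r>0$ let $\ell^r(m_T)=\{f:\ |f|^r\in\ell^1(m_T)\}$. Then the following statements are equivalent: (a) there is a continuous linear operator $S\colon\ell^p\to E$ with $S(x)=T(x)$ for all $x\in\ell^1$; (b) $\ell^p\subset\ell^1(m_T)$; (c) $\ell^1\subset\ell^{1/p}(m_T)\cap\ell^1(m_T)$; (d) there exists $C>0$ such that $$\Big\|\sum_{j\in M}x_jT(e_j)\Big\|_E\le C\Big(\sum_{j\in M}x_j^p\Big)^{1/p}$$ for all finite $M\subset\mathbb{N}$ and all $(x_j)_{j\in M}\subset[0,\infty)$. -/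

import Mathlib

open MeasureTheory Filter Topology
open scoped ENNReal

universe u v w

/-- A `δ`-ring of subsets of `Ω`: a ring of sets closed under countable intersections. -/
structure DeltaRing (Ω : Type u) where
  sets : Set (Set Ω)
  isSetRing : IsSetRing sets
  iInter_mem : ∀ A : ℕ → Set Ω, (∀ n, A n ∈ sets) → (⋂ n, A n) ∈ sets

namespace DeltaRing

variable {Ω : Type u}

/-- The `σ`-algebra `R^loc` of all sets `A` such that `A ∩ B ∈ R` for every `B ∈ R`. -/
@[reducible] def loc (R : DeltaRing Ω) : MeasurableSpace Ω where
  MeasurableSet' A := ∀ B ∈ R.sets, A ∩ B ∈ R.sets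
  measurableSet_empty := fun B _ => by
    rw [Set.empty_inter]; exact R.isSetRing.empty_mem
  measurableSet_compl := fun A hA B hB => by
    have h : Aᶜ ∩ B = B \ (A ∩ B) := by ext; simp; tauto
    rw [h]; exact R.isSetRing.sdiff_mem hB (hA B hB)
  measurableSet_iUnion := fun A hA B hB => by
    have h : (⋃ n, A n) ∩ B = B \ ⋂ n, (B \ (A n ∩ B)) := by
      ext x; simp; tauto
    rw [h]
    exact R.isSetRing.sdiff_mem hB
      (R.iInter_mem _ fun n => R.isSetRing.sdiff_mem hB (hA n B hB))

end DeltaRing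

/-- A vector measure on a `δ`-ring `R` with values in `E`: `∑ m(Aₙ)` converges to `m(⋃ Aₙ)` for
every disjoint sequence `(Aₙ)` in `R` whose union is in `R`. (The value outside `R` is irrelevant
and is set to `0`.) -/
structure DeltaMeasure {Ω : Type u} (R : DeltaRing Ω) (E : Type v)
    [NormedAddCommGroup E] where
  toFun : Set Ω → E
  eq_zero_of_notMem : ∀ A, A ∉ R.sets → toFun A = 0
  hasSum_iUnion : ∀ A : ℕ → Set Ω, (∀ n, A n ∈ R.sets) → Pairwise (Function.onFun Disjoint A) →
    (⋃ n, A n) ∈ R.sets → HasSum (fun n => toFun (A n)) (toFun (⋃ n, A n))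

namespace DeltaMeasure

variable {Ω : Type u} {R : DeltaRing Ω} {E : Type v} [NormedAddCommGroup E]

theorem toFun_empty (m : DeltaMeasure R E) : m.toFun ∅ = 0 := by
  have h := m.hasSum_iUnion (fun _ => ∅) (fun _ => R.isSetRing.empty_mem)
    (fun i j _ => by simp [Function.onFun]) (by simpa using R.isSetRing.empty_mem)
  have h0 := h.summable.tendsto_atTop_zero
  exact tendsto_nhds_unique tendsto_const_nhds h0

/-- The composition `x* m` of a vector measure with a continuous linear map. -/
def comp {F : Type w} [NormedAddCommGroup F] [NormedSpace ℝ E] [NormedSpace ℝ F]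
    (x : E →L[ℝ] F) (m : DeltaMeasure R E) : DeltaMeasure R F where
  toFun A := x (m.toFun A)
  eq_zero_of_notMem A hA := by rw [m.eq_zero_of_notMem A hA, map_zero]
  hasSum_iUnion A hA hd hU := (m.hasSum_iUnion A hA hd hU).mapL x

/-- The variation as a set function: the supremum of `∑ ‖m(B)‖` over all finite disjoint
families of members `B ⊆ A` of `R`. -/
noncomputable def variationFun (m : DeltaMeasure R E) (A : Set Ω) : ℝ≥0∞ :=
  ⨆ s : {s : Finset (Set Ω) // (∀ B ∈ s, B ∈ R.sets ∧ B ⊆ A) ∧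
    (s : Set (Set Ω)).PairwiseDisjoint id}, ∑ B ∈ s.1, ‖m.toFun B‖ₑ

theorem variationFun_mono (m : DeltaMeasure R E) {A A' : Set Ω} (h : A ⊆ A') :
    m.variationFun A ≤ m.variationFun A' :=
  iSup_le fun s => le_iSup_of_le
    ⟨s.1, fun B hB => ⟨(s.2.1 B hB).1, (s.2.1 B hB).2.trans h⟩, s.2.2⟩ le_rfl

theorem variationFun_empty (m : DeltaMeasure R E) : m.variationFun ∅ = 0 := by
  refine le_antisymm (iSup_le fun s => ?_) zero_le
  refine (Finset.sum_eq_zero fun B hB => ?_).le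
  rw [Set.subset_empty_iff.1 (s.2.1 B hB).2, m.toFun_empty, enorm_zero]

theorem variationFun_union_le (m : DeltaMeasure R E) {A A' : Set Ω} (h : Disjoint A A') :
    m.variationFun A + m.variationFun A' ≤ m.variationFun (A ∪ A') := by
  classical
  have : Nonempty {s : Finset (Set Ω) // (∀ B ∈ s, B ∈ R.sets ∧ B ⊆ A) ∧
    (s : Set (Set Ω)).PairwiseDisjoint id} := ⟨⟨∅, by simp⟩⟩
  have : Nonempty {s : Finset (Set Ω) // (∀ B ∈ s, B ∈ R.sets ∧ B ⊆ A') ∧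
    (s : Set (Set Ω)).PairwiseDisjoint id} := ⟨⟨∅, by simp⟩⟩
  refine ENNReal.iSup_add_iSup_le fun s t => ?_
  have hst : Disjoint s.1 (t.1.erase ∅) := by
    rw [Finset.disjoint_left]
    intro B hs ht
    rw [Finset.mem_erase] at ht
    exact ht.1 (Set.subset_empty_iff.1 (h (s.2.1 B hs).2 (t.2.1 B ht.2).2))
  have ht : ∑ B ∈ t.1, ‖m.toFun B‖ₑ = ∑ B ∈ t.1.erase ∅, ‖m.toFun B‖ₑ :=
    (Finset.sum_erase t.1 (f := fun B => ‖m.toFun B‖ₑ)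
      (by simp [m.toFun_empty])).symm
  rw [ht, ← Finset.sum_union hst]
  refine le_iSup_of_le ⟨s.1 ∪ t.1.erase ∅, ?_, ?_⟩ le_rfl
  · intro B hB
    rcases Finset.mem_union.1 hB with hB | hB
    · exact ⟨(s.2.1 B hB).1, (s.2.1 B hB).2.trans Set.subset_union_left⟩
    · have hB := Finset.mem_of_mem_erase hB
      exact ⟨(t.2.1 B hB).1, (t.2.1 B hB).2.trans Set.subset_union_right⟩
  · intro B hB C hC hBC
    rcases Finset.mem_union.1 hB with hB | hB <;> rcases Finset.mem_union.1 hC with hC | hC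
    · exact s.2.2 hB hC hBC
    · exact h.mono (s.2.1 B hB).2 (t.2.1 C (Finset.mem_of_mem_erase hC)).2
    · exact h.symm.mono (t.2.1 B (Finset.mem_of_mem_erase hB)).2 (s.2.1 C hC).2
    · exact t.2.2 (Finset.mem_of_mem_erase hB) (Finset.mem_of_mem_erase hC) hBC

theorem variationFun_iUnion (m : DeltaMeasure R E) (A : ℕ → Set Ω)
    (hA : ∀ n, ∀ B ∈ R.sets, A n ∩ B ∈ R.sets) (hd : Pairwise (Function.onFun Disjoint A)) :
    m.variationFun (⋃ n, A n) = ∑' n, m.variationFun (A n) := by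
  classical
  apply le_antisymm
  · refine iSup_le fun s => ?_
    have h1 : ∀ B ∈ s.1, ‖m.toFun B‖ₑ ≤ ∑' n, ‖m.toFun (A n ∩ B)‖ₑ := by
      intro B hB
      have hU : (⋃ n, A n ∩ B) = B := by
        rw [← Set.iUnion_inter]; exact Set.inter_eq_right.2 (s.2.1 B hB).2
      have hs := m.hasSum_iUnion (fun n => A n ∩ B) (fun n => hA n B (s.2.1 B hB).1)
        (fun i j hij => (hd hij).mono Set.inter_subset_left Set.inter_subset_left)
        (by rw [hU]; exact (s.2.1 B hB).1)
      rw [hU] at hs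
      rw [← hs.tsum_eq]
      exact enorm_tsum_le_tsum_enorm
    calc ∑ B ∈ s.1, ‖m.toFun B‖ₑ ≤ ∑ B ∈ s.1, ∑' n, ‖m.toFun (A n ∩ B)‖ₑ :=
          Finset.sum_le_sum h1
      _ = ∑' n, ∑ B ∈ s.1, ‖m.toFun (A n ∩ B)‖ₑ :=
          (Summable.tsum_finsetSum fun _ _ => ENNReal.summable).symm
      _ ≤ ∑' n, m.variationFun (A n) := by
          refine ENNReal.tsum_le_tsum fun n => ?_
          have himg : ∑ B ∈ s.1, ‖m.toFun (A n ∩ B)‖ₑ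
              = ∑ C ∈ Finset.image (fun B => A n ∩ B) s.1, ‖m.toFun C‖ₑ := by
            refine (Finset.sum_image_of_pairwise_eq_zero (I := s.1)
              (f := fun B => A n ∩ B) (g := fun C => ‖m.toFun C‖ₑ) ?_).symm
            intro B hB C hC hBC hEq
            have hdis : Disjoint (A n ∩ B) (A n ∩ C) :=
              (s.2.2 hB hC hBC).mono Set.inter_subset_right Set.inter_subset_right
            have hEq' : A n ∩ B = A n ∩ C := hEq
            rw [← hEq', disjoint_self] at hdis
            change ‖m.toFun (A n ∩ B)‖ₑ = 0
            rw [hdis]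
            simp [m.toFun_empty]
          rw [himg]
          refine le_iSup_of_le ⟨s.1.image (fun B => A n ∩ B), ?_, ?_⟩ le_rfl
          · intro C hC
            obtain ⟨B, hB, rfl⟩ := Finset.mem_image.1 hC
            exact ⟨hA n B (s.2.1 B hB).1, Set.inter_subset_left⟩
          · intro C hC D hD hCD
            obtain ⟨B, hB, rfl⟩ := Finset.mem_image.1 hC
            obtain ⟨B', hB', rfl⟩ := Finset.mem_image.1 hD
            have hne : B ≠ B' := fun h => hCD (by rw [h])
            exact (s.2.2 hB hB' hne).mono Set.inter_subset_right Set.inter_subset_right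
  · refine ENNReal.summable.tsum_le_of_sum_le fun t => ?_
    have key : ∑ n ∈ t, m.variationFun (A n) ≤ m.variationFun (⋃ n ∈ t, A n) := by
      induction t using Finset.induction_on with
      | empty => simp
      | insert a t ha ih =>
        rw [Finset.sum_insert ha, Finset.set_biUnion_insert]
        refine le_trans (add_le_add le_rfl ih) (m.variationFun_union_le ?_)
        rw [Set.disjoint_iUnion₂_right]
        intro n hn
        exact hd (fun h => ha (h ▸ hn))
    exact key.trans (m.variationFun_mono (Set.iUnion₂_subset fun n _ => Set.subset_iUnion A n))

/-- The variation `|m|`, a measure on `R^loc`. -/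
noncomputable def variation (m : DeltaMeasure R E) : @Measure Ω R.loc :=
  @Measure.ofMeasurable Ω R.loc (fun A _ => m.variationFun A) m.variationFun_empty
    (fun A hA hd => m.variationFun_iUnion A hA hd)

theorem variation_apply (m : DeltaMeasure R E) {A : Set Ω} (hA : MeasurableSet[R.loc] A) :
    m.variation A = m.variationFun A := by
  let _ : MeasurableSpace Ω := R.loc
  exact @Measure.ofMeasurable_apply Ω R.loc _ m.variationFun_empty
    (fun A hA hd => m.variationFun_iUnion A hA hd) A hA

/-- `∫_A φ dλ = ∑ αⱼ λ(Aⱼ ∩ A)` for a simple function `φ = ∑ αⱼ χ_{Aⱼ}` in canonical form;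
meaningful when the support of `φ` is in `R`. -/
noncomputable def simpleIntegral (l : DeltaMeasure R ℝ) (φ : @SimpleFunc Ω R.loc ℝ)
    (A : Set Ω) : ℝ :=
  ∑ a ∈ @SimpleFunc.range Ω ℝ R.loc φ, a * l.toFun (φ ⁻¹' {a} ∩ A)

/-- `f ∈ L¹(λ)` and `∫_A f dλ = c` for a real measure `λ` on a `δ`-ring: `c` is the limit of
`∫_A φₙ dλ` for a sequence of simple functions with support in `R` that converges to `f` in
`L¹(|λ|)`. -/
def HasRealIntegral (l : DeltaMeasure R ℝ) (f : Ω → ℝ) (A : Set Ω) (c : ℝ) : Prop :=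
  Integrable f l.variation ∧
  ∃ φ : ℕ → @SimpleFunc Ω R.loc ℝ,
    (∀ n, Function.support (φ n) ∈ R.sets) ∧
    Tendsto (fun n => ∫⁻ t, ‖φ n t - f t‖ₑ ∂l.variation) atTop (𝓝 0) ∧
    Tendsto (fun n => l.simpleIntegral (φ n) A) atTop (𝓝 c)

variable [NormedSpace ℝ E]

/-- The functions in `L¹(m)`, given by representatives (which are determined up to `m`-null sets;
when `T e_n ≠ 0` for all `n`, the measure `m_T` below has no null set except `∅`): the `R^loc`-measurable `f` such that
`f ∈ L¹(x* m)` for every `x* ∈ E*` and, for each `A ∈ R^loc`, there is `x_A ∈ E` with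
`x*(x_A) = ∫_A f d(x* m)` for every `x* ∈ E*`. -/
def L1 (m : DeltaMeasure R E) : Set (Ω → ℝ) :=
  {f | Measurable[R.loc] f ∧
    (∀ x : E →L[ℝ] ℝ, Integrable f (m.comp x).variation) ∧
    ∀ A : Set Ω, MeasurableSet[R.loc] A →
      ∃ y : E, ∀ x : E →L[ℝ] ℝ, (m.comp x).HasRealIntegral f A (x y)}

/-- The space `L^r(m)`, `r > 0`: the `r`-power `{f : |f|^r ∈ L¹(m)}` of `L¹(m)`. -/
def LPow (m : DeltaMeasure R E) (r : ℝ) : Set (Ω → ℝ) :=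
  {f | Measurable[R.loc] f ∧ (fun t => |f t| ^ r) ∈ m.L1}

end DeltaMeasure

/-- The `δ`-ring of all finite subsets of `ℕ`, i.e. of the sets `A` with `χ_A ∈ ℓ¹`. -/
def finiteSets : DeltaRing ℕ where
  sets := {A | A.Finite}
  isSetRing :=
    { empty_mem := Set.finite_empty
      union_mem := fun _ _ hs ht => Set.Finite.union hs ht
      sdiff_mem := fun _ _ hs _ => Set.Finite.subset hs Set.sdiff_subset }
  iInter_mem := fun A hA => Set.Finite.subset (hA 0) (Set.iInter_subset A 0)

/-- The real sequence space `ℓ^p` as a set of sequences. -/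
def ellSet (p : ℝ) : Set (ℕ → ℝ) := {x | Memℓp x (ENNReal.ofReal p)}

/-- The Banach space `ℓ¹` of real sequences. -/
abbrev Ell1 : Type := lp (fun _ : ℕ => ℝ) 1

namespace Ell1

/-- The characteristic function `χ_A ∈ ℓ¹` of a finite set `A`. -/
noncomputable def chi (A : Set ℕ) (hA : A.Finite) : Ell1 :=
  ⟨A.indicator fun _ => (1 : ℝ), (memℓp_zero (hA.subset fun n hn => by
    by_contra h
    exact hn (Set.indicator_of_notMem h _))).of_exponent_ge zero_le⟩

/-- The unit vector `e_n = χ_{n}`. -/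
noncomputable def e (n : ℕ) : Ell1 := chi {n} (Set.finite_singleton n)

theorem chi_eq_sum (A : Finset ℕ) : chi (A : Set ℕ) A.finite_toSet = ∑ n ∈ A, e n := by
  ext k
  rw [lp.coeFn_sum, Finset.sum_apply]
  simp [chi, e, Set.indicator_apply]

end Ell1

section Operators

variable {E : Type v} [NormedAddCommGroup E] [NormedSpace ℝ E]

open Classical in
/-- The vector measure `m_T(A) = T(χ_A)` on the finite subsets of `ℕ` associated with a continuous
linear operator `T : ℓ¹ → E`. -/
noncomputable def assocMeasure (T : Ell1 →L[ℝ] E) : DeltaMeasure finiteSets E where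
  toFun A := if hA : A.Finite then T (Ell1.chi A hA) else 0
  eq_zero_of_notMem A hA := dif_neg hA
  hasSum_iUnion A hA hd hU := by
    have hU' : (⋃ n, A n).Finite := hU
    have hA' : ∀ n, (A n).Finite := hA
    have hfin : {n | (A n).Nonempty}.Finite := by
      have hex : ∀ n : {n | (A n).Nonempty}, ∃ k : (⋃ n, A n : Set ℕ), (k : ℕ) ∈ A n :=
        fun n => ⟨⟨n.2.some, Set.mem_iUnion.2 ⟨n, n.2.some_mem⟩⟩, n.2.some_mem⟩
      choose g hg using hex
      have : Finite (⋃ n, A n : Set ℕ) := hU'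
      have hinj : Function.Injective g := by
        intro i j hij
        by_contra hne
        have h1 := hg i
        rw [hij] at h1
        exact Set.disjoint_left.1 (hd fun h => hne (Subtype.ext h)) h1 (hg j)
      exact Set.finite_coe_iff.1 (Finite.of_injective g hinj)
    have hUeq : (⋃ n ∈ hfin.toFinset, A n) = ⋃ n, A n := by
      ext k
      simp only [Set.mem_iUnion, Set.Finite.mem_toFinset, Set.mem_ofPred_eq, exists_prop]
      exact ⟨fun ⟨n, _, h⟩ => ⟨n, h⟩, fun ⟨n, h⟩ => ⟨n, ⟨k, h⟩, h⟩⟩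
    have hsum : Ell1.chi (⋃ n, A n) hU' = ∑ n ∈ hfin.toFinset, Ell1.chi (A n) (hA' n) := by
      ext k
      rw [lp.coeFn_sum, Finset.sum_apply]
      have h := Finset.indicator_biUnion hfin.toFinset A
        (fun i _ j _ hij => hd hij) (f := fun _ : ℕ => (1 : ℝ))
      rw [hUeq] at h
      exact congrFun h k
    rw [dif_pos hU', hsum, map_sum]
    have hfun : (fun n => if hn : (A n).Finite then T (Ell1.chi (A n) hn) else 0)
        = fun n => T (Ell1.chi (A n) (hA' n)) := funext fun n => dif_pos (hA' n)
    rw [hfun]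
    refine hasSum_sum_of_ne_finset_zero fun n hn => ?_
    have hn0 : A n = ∅ := by
      rw [Set.Finite.mem_toFinset] at hn
      exact Set.not_nonempty_iff_eq_empty.1 hn
    have hz : Ell1.chi (A n) (hA' n) = 0 := by
      ext k
      simp [Ell1.chi, hn0]
    rw [hz, map_zero]

/-- For `1 < p < ∞`: there is a continuous linear operator `S : ℓ^p → E` that extends `T`. -/
def ExtendsToEll (T : Ell1 →L[ℝ] E) (p : ℝ) (hp : 1 < p) : Prop :=
  haveI : Fact ((1 : ℝ≥0∞) ≤ ENNReal.ofReal p) := ⟨ENNReal.one_le_ofReal.2 hp.le⟩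
  ∃ S : lp (fun _ : ℕ => ℝ) (ENNReal.ofReal p) →L[ℝ] E,
    ∀ x : Ell1, S ⟨x, lp.monotone (ENNReal.one_le_ofReal.2 hp.le) x.2⟩ = T x

end Operators

/-! Everything is read off the vectors `T (Ell1.e n)`. On finite subsets of ℕ the variation of a
measure is counting measure weighted by the norms of its atoms, so integrability against x*m_T means
absolute convergence of ∑ f n * x*(T e_n) (`integrable_variation_iff`), and summability of every
subseries of ∑ f n • T e_n puts f in `L1` (`mem_L1_assocMeasure_of_summable_indicator`).

An extension S maps the coordinate expansion of f·χ_A in ℓ^p to such a subseries, so (a) gives (b).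
Taking p-th roots turns ℓ¹ into ℓ^p, so (b) gives (c). From (c), ∑ f n • T e_n is weakly absolutely
summable for f in ℓ^p, and two uses of uniform boundedness yield the estimate (d)
(`lp.exists_bound_of_weakly_summable`). Conversely, (d) makes these series Cauchy for f in ℓ^p, and
their sums define S (`lp.exists_continuousLinearMap_of_sum_bound`). -/

/-! ### Vector series with coefficients in ℓ^q -/

section PowerSums

variable {E : Type*} [NormedAddCommGroup E] [NormedSpace ℝ E]

/-- A power bound for sums with nonnegative coefficients implies, with twice the constant, the
same bound for arbitrary real coefficients. -/
theorem norm_sum_smul_le_two_mul_of_nonneg {p : ℝ} (hp : 0 < p) {v : ℕ → E} {C : ℝ} (hC : 0 ≤ C)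
    (h : ∀ (M : Finset ℕ) (x : ℕ → ℝ), (∀ j ∈ M, 0 ≤ x j) →
      ‖∑ j ∈ M, x j • v j‖ ≤ C * (∑ j ∈ M, x j ^ p) ^ (1 / p))
    (M : Finset ℕ) (x : ℕ → ℝ) :
    ‖∑ j ∈ M, x j • v j‖ ≤ 2 * C * (∑ j ∈ M, |x j| ^ p) ^ (1 / p) := by
  -- Used for y = x⁺ and y = x⁻; each contributes one C to the factor 2.
  have hpart : ∀ y : ℕ → ℝ, (∀ j, 0 ≤ y j) → (∀ j, y j ≤ |x j|) →
      ‖∑ j ∈ M, y j • v j‖ ≤ C * (∑ j ∈ M, |x j| ^ p) ^ (1 / p) := fun y hy hyx => by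
    refine (h M y fun j _ => hy j).trans (mul_le_mul_of_nonneg_left ?_ hC)
    refine Real.rpow_le_rpow (Finset.sum_nonneg fun j _ => Real.rpow_nonneg (hy j) p) ?_
      (by positivity)
    exact Finset.sum_le_sum fun j _ => Real.rpow_le_rpow (hy j) (hyx j) hp.le
  have h₁ := hpart (fun j => (x j)⁺) (fun j => posPart_nonneg _)
    fun j => sup_le (le_abs_self _) (abs_nonneg _)
  have h₂ := hpart (fun j => (x j)⁻) (fun j => negPart_nonneg _)
    fun j => sup_le (neg_le_abs _) (abs_nonneg _)
  have hsplit : ∑ j ∈ M, x j • v j = ∑ j ∈ M, (x j)⁺ • v j - ∑ j ∈ M, (x j)⁻ • v j := by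
    rw [← Finset.sum_sub_distrib]
    exact Finset.sum_congr rfl fun j _ => by rw [← sub_smul, posPart_sub_negPart]
  rw [hsplit]
  exact (norm_sub_le _ _).trans (by linarith)

variable {q : ℝ≥0∞} [Fact (1 ≤ q)]

/-- If finite sums `∑ xⱼ vⱼ` are bounded by the `ℓ^q` norm of the coefficients, then `∑ fⱼ vⱼ`
is summable for every `f ∈ ℓ^q`. -/
theorem lp.summable_smul_of_sum_bound [CompleteSpace E] (hq : q ≠ ∞) {v : ℕ → E} {K : ℝ}
    (hK : 0 ≤ K) (h : ∀ (M : Finset ℕ) (x : ℕ → ℝ),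
      ‖∑ j ∈ M, x j • v j‖ ≤ K * (∑ j ∈ M, |x j| ^ q.toReal) ^ (1 / q.toReal))
    (f : lp (fun _ : ℕ => ℝ) q) : Summable fun j => f j • v j := by
  have hq0 : 0 < q.toReal := ENNReal.toReal_pos (zero_lt_one.trans_le Fact.out).ne' hq
  rw [summable_iff_vanishing_norm]
  intro ε hε
  -- K + 1 instead of K keeps the quotient meaningful when K = 0.
  have hδ : 0 < (ε / (K + 1)) ^ q.toReal := by positivity
  obtain ⟨s, hs⟩ := summable_iff_vanishing_norm.1 ((lp.memℓp f).summable hq0) _ hδ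
  refine ⟨s, fun t ht => (h t f).trans_lt ?_⟩
  have h0 : 0 ≤ ∑ j ∈ t, |f j| ^ q.toReal := Finset.sum_nonneg fun _ _ => by positivity
  have hlt : (∑ j ∈ t, |f j| ^ q.toReal) ^ (1 / q.toReal) < ε / (K + 1) := by
    have := (le_abs_self _).trans_lt (hs t ht)
    rw [one_div]
    exact (Real.rpow_inv_lt_iff_of_pos h0 (by positivity) hq0).2 this
  calc K * (∑ j ∈ t, |f j| ^ q.toReal) ^ (1 / q.toReal)
      ≤ K * (ε / (K + 1)) := mul_le_mul_of_nonneg_left hlt.le hK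
    _ < (K + 1) * (ε / (K + 1)) := mul_lt_mul_of_pos_right (by linarith) (by positivity)
    _ = ε := by field_simp

/-- A sequence `v` whose finite sums `∑ xⱼ vⱼ` are bounded by the `ℓ^q` norm of the coefficients
defines a continuous linear operator on `ℓ^q`. -/
theorem lp.exists_continuousLinearMap_of_sum_bound [CompleteSpace E] (hq : q ≠ ∞) {v : ℕ → E}
    {K : ℝ} (hK : 0 ≤ K) (h : ∀ (M : Finset ℕ) (x : ℕ → ℝ),
      ‖∑ j ∈ M, x j • v j‖ ≤ K * (∑ j ∈ M, |x j| ^ q.toReal) ^ (1 / q.toReal)) :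
    ∃ S : lp (fun _ : ℕ => ℝ) q →L[ℝ] E, ∀ f, HasSum (fun j => f j • v j) (S f) := by
  have hq0 : 0 < q.toReal := ENNReal.toReal_pos (zero_lt_one.trans_le Fact.out).ne' hq
  have hs := lp.summable_smul_of_sum_bound hq hK h
  let L : lp (fun _ : ℕ => ℝ) q →ₗ[ℝ] E :=
    { toFun := fun f => ∑' j, f j • v j
      map_add' := fun f g => by
        rw [← (hs f).tsum_add (hs g)]
        exact tsum_congr fun j => by rw [lp.coeFn_add, Pi.add_apply, add_smul]
      map_smul' := fun c f => by
        rw [RingHom.id_apply, ← (hs f).tsum_const_smul c]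
        exact tsum_congr fun j => by
          rw [lp.coeFn_smul, Pi.smul_apply, smul_eq_mul, mul_smul] }
  refine ⟨L.mkContinuous K fun f => ?_, fun f => (hs f).hasSum⟩
  refine le_of_tendsto (hs f).hasSum.norm (Eventually.of_forall fun M => (h M f).trans ?_)
  refine mul_le_mul_of_nonneg_left ?_ hK
  rw [one_div]
  exact (Real.rpow_inv_le_iff_of_pos (Finset.sum_nonneg fun _ _ => by positivity)
    (norm_nonneg _) hq0).2 (lp.sum_rpow_le_norm_rpow hq0 f M)

/-- If `∑ fₙ vₙ` is weakly absolutely summable for every `f ∈ ℓ^q`, then the norms of the finite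
sums `∑ fₙ vₙ` are bounded by the `ℓ^q` norm of `f`. -/
theorem lp.exists_bound_of_weakly_summable {v : ℕ → E}
    (h : ∀ (f : lp (fun _ : ℕ => ℝ) q) (x : E →L[ℝ] ℝ), Summable fun n => |f n| * |x (v n)|) :
    ∃ C : ℝ, ∀ (M : Finset ℕ) (f : lp (fun _ : ℕ => ℝ) q),
      ‖∑ n ∈ M, f n • v n‖ ≤ C * ‖f‖ := by
  let S : Finset ℕ → lp (fun _ : ℕ => ℝ) q →L[ℝ] E := fun M =>
    ∑ n ∈ M, (lp.evalCLM ℝ (fun _ : ℕ => ℝ) q n).smulRight (v n)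
  have hS : ∀ M f, S M f = ∑ n ∈ M, f n • v n := fun M f => by
    simp only [S, sum_apply, ContinuousLinearMap.smulRight_apply]
    rfl
  -- First uniform boundedness, on the dual of E, which is complete even if E is not: the vectors `S
  -- M f` act as functionals on it, pointwise bounded by the weak sums.
  have hweak : ∀ f, ∃ C, ∀ M, ‖S M f‖ ≤ C := fun f => by
    obtain ⟨C, hC⟩ := banach_steinhaus
      (g := fun M => NormedSpace.inclusionInDoubleDualLi ℝ (S M f)) fun x =>
        ⟨∑' n, |f n| * |x (v n)|, fun M => by
          change ‖x (S M f)‖ ≤ _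
          rw [hS, map_sum]
          refine (norm_sum_le _ _).trans (le_trans (le_of_eq ?_)
            ((h f x).sum_le_tsum M fun _ _ => by positivity))
          exact Finset.sum_congr rfl fun n _ => by
            rw [map_smul, smul_eq_mul, norm_mul, Real.norm_eq_abs, Real.norm_eq_abs]⟩
    exact ⟨C, fun M =>
      ((NormedSpace.inclusionInDoubleDualLi ℝ).norm_map (S M f)).symm.trans_le (hC M)⟩
  -- Second uniform boundedness, now on the Banach space ℓ^q.
  obtain ⟨C, hC⟩ := banach_steinhaus hweak
  exact ⟨C, fun M f => hS M f ▸ (S M).le_of_opNorm_le (hC M) f⟩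

end PowerSums

/-! ### Measures on the finite subsets of ℕ: integrals as series -/

section SequenceMeasures

theorem measurableSet_finiteSets_loc (A : Set ℕ) : MeasurableSet[finiteSets.loc] A :=
  fun _ hB => Set.Finite.subset hB Set.inter_subset_right

theorem measurable_finiteSets_loc {β : Type*} [MeasurableSpace β] (f : ℕ → β) :
    Measurable[finiteSets.loc] f :=
  fun _ _ => measurableSet_finiteSets_loc _

namespace DeltaMeasure

theorem variationFun_singleton {E : Type*} [NormedAddCommGroup E]
    (m : DeltaMeasure finiteSets E) (n : ℕ) : m.variationFun {n} = ‖m.toFun {n}‖ₑ := by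
  classical
  refine le_antisymm (iSup_le fun s => ?_) ?_
  · have hsub : s.1 ⊆ {∅, {n}} := fun B hB => by
      simpa using Set.subset_singleton_iff_eq.1 (s.2.1 B hB).2
    refine (Finset.sum_le_sum_of_subset hsub).trans ?_
    rw [Finset.sum_pair (Set.singleton_ne_empty n).symm, m.toFun_empty, enorm_zero, zero_add]
  · refine le_iSup_of_le ⟨{{n}}, ?_, ?_⟩ ?_
    · intro B hB
      rw [Finset.mem_singleton.1 hB]
      exact ⟨Set.finite_singleton n, subset_rfl⟩
    · simp
    · simp

/-- ℕ is countable with measurable singletons, so the variation is determined by its atoms. -/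
theorem lintegral_variation {E : Type*} [NormedAddCommGroup E]
    (m : DeltaMeasure finiteSets E) (g : ℕ → ℝ≥0∞) :
    ∫⁻ n, g n ∂m.variation = ∑' n, g n * ‖m.toFun {n}‖ₑ := by
  let _ : MeasurableSpace ℕ := finiteSets.loc
  have : MeasurableSingletonClass ℕ := ⟨fun n => measurableSet_finiteSets_loc {n}⟩
  rw [lintegral_countable']
  exact tsum_congr fun n => by
    rw [variation_apply _ (measurableSet_finiteSets_loc _), variationFun_singleton]

theorem integrable_variation_iff {E : Type*} [NormedAddCommGroup E]
    (m : DeltaMeasure finiteSets E) (f : ℕ → ℝ) :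
    Integrable f m.variation ↔ Summable fun n => |f n| * ‖m.toFun {n}‖ := by
  have hmeas := (measurable_finiteSets_loc f).aestronglyMeasurable (μ := m.variation)
  have hterm : ∀ n, ‖f n‖ₑ * ‖m.toFun {n}‖ₑ = ENNReal.ofReal (|f n| * ‖m.toFun {n}‖) :=
    fun n => by
      rw [ENNReal.ofReal_mul (abs_nonneg _), ofReal_norm, ← Real.norm_eq_abs, ofReal_norm]
  have hfin : Integrable f m.variation ↔
      ∑' n, ENNReal.ofReal (|f n| * ‖m.toFun {n}‖) ≠ ∞ := by
    rw [Integrable, and_iff_right hmeas, hasFiniteIntegral_iff_enorm, lintegral_variation,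
      lt_top_iff_ne_top]
    simp only [hterm]
  rw [hfin]
  refine ⟨fun h => ?_, fun h => h.tsum_ofReal_ne_top⟩
  refine (ENNReal.summable_toReal h).congr fun n => ?_
  exact ENNReal.toReal_ofReal (by positivity)

theorem toFun_coe_finset {E : Type*} [NormedAddCommGroup E]
    (m : DeltaMeasure finiteSets E) (B : Finset ℕ) :
    m.toFun B = ∑ n ∈ B, m.toFun {n} := by
  -- Additivity is given for sequences only, so the singletons of B are padded with ∅.
  have hU : (⋃ n, if n ∈ B then ({n} : Set ℕ) else ∅) = B := by
    ext k
    simp only [Set.mem_iUnion, Finset.mem_coe]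
    refine ⟨fun ⟨n, hn⟩ => ?_, fun hk => ⟨k, by simp [hk]⟩⟩
    split_ifs at hn with h
    · rwa [Set.mem_singleton_iff.1 hn]
    · exact hn.elim
  have hs := m.hasSum_iUnion (fun n => if n ∈ B then {n} else ∅)
    (fun n => by
      change Set.Finite _
      split_ifs <;> simp)
    (fun i j hij => by
      simp only [Function.onFun]
      split_ifs <;> simp [hij])
    (by rw [hU]; exact B.finite_toSet)
  rw [hU] at hs
  refine (hs.unique (hasSum_sum_of_ne_finset_zero (s := B) fun n hn => ?_)).trans
    (Finset.sum_congr rfl fun n hn => by rw [if_pos hn])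
  rw [if_neg hn, m.toFun_empty]

/-- The simple function that agrees with `f` on `{0, …, N - 1}` and vanishes elsewhere. -/
noncomputable def truncation (f : ℕ → ℝ) (N : ℕ) : @SimpleFunc ℕ finiteSets.loc ℝ :=
  @SimpleFunc.mk ℕ finiteSets.loc ℝ ((Finset.range N : Set ℕ).indicator f)
    (fun _ => measurableSet_finiteSets_loc _)
    (((Finset.range N).finite_toSet.image f).insert 0 |>.subset <| by
      rintro _ ⟨n, rfl⟩
      by_cases hn : n ∈ (Finset.range N : Set ℕ)
      · exact Or.inr ⟨n, hn, (Set.indicator_of_mem hn f).symm⟩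
      · exact Or.inl (Set.indicator_of_notMem hn f))

theorem truncation_apply (f : ℕ → ℝ) (N n : ℕ) :
    truncation f N n = (Finset.range N : Set ℕ).indicator f n := rfl

theorem support_truncation_subset (f : ℕ → ℝ) (N : ℕ) :
    Function.support (truncation f N) ⊆ Finset.range N :=
  Set.support_indicator_subset

open Classical in
theorem simpleIntegral_truncation (l : DeltaMeasure finiteSets ℝ) (f : ℕ → ℝ) (N : ℕ)
    (A : Set ℕ) :
    l.simpleIntegral (truncation f N) A =
      ∑ n ∈ Finset.range N, A.indicator f n * l.toFun {n} := by
  have hterm : ∀ a : ℝ, a * l.toFun (truncation f N ⁻¹' {a} ∩ A) =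
      ∑ n ∈ Finset.range N, if truncation f N n = a then A.indicator f n * l.toFun {n} else 0 := by
    intro a
    rcases eq_or_ne a 0 with rfl | ha
    -- The fibre over 0 may be infinite, outside the δ-ring; its coefficient 0 makes its measure
    -- irrelevant.
    · rw [zero_mul]
      refine (Finset.sum_eq_zero fun n hn => ?_).symm
      split_ifs with h
      · rw [truncation_apply, Set.indicator_of_mem (Finset.mem_coe.2 hn)] at h
        simp [Set.indicator_apply, h]
      · rfl
    · have hset : truncation f N ⁻¹' {a} ∩ A =
          ((Finset.range N).filter fun n => truncation f N n = a ∧ n ∈ A : Finset ℕ) := by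
        ext n
        simp only [Set.mem_inter_iff, Set.mem_preimage, Set.mem_singleton_iff, Finset.coe_filter,
          Set.mem_ofPred_eq]
        refine ⟨fun h => ⟨?_, h⟩, fun h => h.2⟩
        exact support_truncation_subset f N (by rw [Function.mem_support, h.1]; exact ha)
      rw [hset, toFun_coe_finset, Finset.sum_filter, Finset.mul_sum]
      refine Finset.sum_congr rfl fun n hn => ?_
      have hf : truncation f N n = f n := Set.indicator_of_mem (Finset.mem_coe.2 hn) f
      by_cases h1 : f n = a <;> by_cases h2 : n ∈ A <;> simp [hf, h1, h2]
  rw [simpleIntegral, Finset.sum_congr rfl fun a _ => hterm a, Finset.sum_comm]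
  refine Finset.sum_congr rfl fun n _ => ?_
  rw [Finset.sum_ite_eq, if_pos]
  exact @SimpleFunc.mem_range_self ℕ ℝ finiteSets.loc (truncation f N) n

/-- Dominated convergence with majorant |f|: at each point the difference is eventually zero. -/
theorem tendsto_lintegral_truncation_sub (l : DeltaMeasure finiteSets ℝ) {f : ℕ → ℝ}
    (hf : Integrable f l.variation) :
    Tendsto (fun N => ∫⁻ t, ‖truncation f N t - f t‖ₑ ∂l.variation) atTop (𝓝 0) := by
  let _ : MeasurableSpace ℕ := finiteSets.loc
  have h := tendsto_lintegral_of_dominated_convergence (μ := l.variation)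
    (F := fun N t => ‖truncation f N t - f t‖ₑ) (f := fun _ => 0) (fun t => ‖f t‖ₑ)
    (fun N => measurable_finiteSets_loc _)
    (fun N => Eventually.of_forall fun t => by
      by_cases ht : t ∈ (Finset.range N : Set ℕ)
      · simp only [truncation_apply, Set.indicator_of_mem ht, sub_self, enorm_zero, zero_le]
      · simp only [truncation_apply, Set.indicator_of_notMem ht, zero_sub, enorm_neg, le_refl])
    hf.2.ne
    (Eventually.of_forall fun t => tendsto_const_nhds.congr' <| by
      filter_upwards [eventually_gt_atTop t] with N hN
      have ht : t ∈ (Finset.range N : Set ℕ) := by simpa using hN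
      simp only [truncation_apply, Set.indicator_of_mem ht, sub_self, enorm_zero])
  simpa using h

theorem hasRealIntegral_of_hasSum (l : DeltaMeasure finiteSets ℝ) {f : ℕ → ℝ} {A : Set ℕ} {c : ℝ}
    (hf : Summable fun n => |f n| * ‖l.toFun {n}‖)
    (hc : HasSum (fun n => A.indicator f n * l.toFun {n}) c) : l.HasRealIntegral f A c := by
  have hint := (l.integrable_variation_iff f).2 hf
  refine ⟨hint, truncation f, fun N => ?_, l.tendsto_lintegral_truncation_sub hint, ?_⟩
  · exact (Finset.range N).finite_toSet.subset (support_truncation_subset f N)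
  · simp only [simpleIntegral_truncation]
    exact hc.tendsto_sum_nat

end DeltaMeasure

end SequenceMeasures

/-! ### The measure of T and the implications between the four conditions -/

section AssociatedMeasure

variable {E : Type*} [NormedAddCommGroup E] [NormedSpace ℝ E]

theorem Ell1.e_eq_single (n : ℕ) : Ell1.e n = lp.single 1 n (1 : ℝ) := by
  ext k
  simp [Ell1.e, Ell1.chi, Pi.single_apply]

theorem assocMeasure_singleton (T : Ell1 →L[ℝ] E) (n : ℕ) :
    (assocMeasure T).toFun {n} = T (Ell1.e n) :=
  dif_pos (Set.finite_singleton n)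

theorem summable_of_mem_L1_assocMeasure {T : Ell1 →L[ℝ] E} {f : ℕ → ℝ}
    (hf : f ∈ (assocMeasure T).L1) (x : E →L[ℝ] ℝ) :
    Summable fun n => |f n| * |x (T (Ell1.e n))| := by
  refine ((DeltaMeasure.integrable_variation_iff _ f).1 (hf.2.1 x)).congr fun n => ?_
  rw [Real.norm_eq_abs]
  exact congrArg (fun y => |f n| * |x y|) (assocMeasure_singleton T n)

theorem mem_L1_assocMeasure_of_summable_indicator {T : Ell1 →L[ℝ] E} {f : ℕ → ℝ}
    (hf : ∀ A : Set ℕ, Summable fun n => A.indicator f n • T (Ell1.e n)) :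
    f ∈ (assocMeasure T).L1 := by
  have hcomp : ∀ (x : E →L[ℝ] ℝ) (n : ℕ),
      ((assocMeasure T).comp x).toFun {n} = x (T (Ell1.e n)) :=
    fun x n => congrArg x (assocMeasure_singleton T n)
  have hsum : ∀ (A : Set ℕ) (x : E →L[ℝ] ℝ),
      HasSum (fun n => A.indicator f n * ((assocMeasure T).comp x).toFun {n})
        (x (∑' n, A.indicator f n • T (Ell1.e n))) := fun A x => by
    refine ((hf A).hasSum.mapL x).congr_fun fun n => ?_
    rw [hcomp, map_smul, smul_eq_mul]
  have habs : ∀ x : E →L[ℝ] ℝ,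
      Summable fun n => |f n| * ‖((assocMeasure T).comp x).toFun {n}‖ := fun x => by
    -- Summability in ℝ is absolute, so A = ℕ already gives integrability.
    refine (hsum Set.univ x).summable.abs.congr fun n => ?_
    rw [Set.indicator_univ, abs_mul, Real.norm_eq_abs]
  exact ⟨measurable_finiteSets_loc f, fun x => (DeltaMeasure.integrable_variation_iff _ f).2 (habs x),
    fun A _ => ⟨_, fun x => DeltaMeasure.hasRealIntegral_of_hasSum _ (habs x) (hsum A x)⟩⟩

theorem memℓp_ofReal_iff {p : ℝ} (hp : 0 < p) {f : ℕ → ℝ} :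
    f ∈ ellSet p ↔ Summable fun n => |f n| ^ p := by
  have h := memℓp_gen_iff (E := fun _ : ℕ => ℝ) (p := ENNReal.ofReal p) (f := f)
    (by rwa [ENNReal.toReal_ofReal hp.le])
  rw [ENNReal.toReal_ofReal hp.le] at h
  exact h

theorem ellSet_subset_L1_of_extendsToEll {T : Ell1 →L[ℝ] E} {p : ℝ} {hp : 1 < p}
    (h : ExtendsToEll T p hp) : ellSet p ⊆ (assocMeasure T).L1 := by
  have : Fact ((1 : ℝ≥0∞) ≤ ENNReal.ofReal p) := ⟨ENNReal.one_le_ofReal.2 hp.le⟩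
  obtain ⟨S, hS⟩ := h
  have hSe : ∀ n, S (lp.single _ n 1) = T (Ell1.e n) := fun n => by
    rw [← hS, Ell1.e_eq_single]
    rfl
  refine fun f hf => mem_L1_assocMeasure_of_summable_indicator fun A => ?_
  have hfA : Memℓp (A.indicator f) (ENNReal.ofReal p) := by
    refine (memℓp_ofReal_iff (zero_lt_one.trans hp)).2 ?_
    refine Summable.of_nonneg_of_le (fun n => by positivity) (fun n => ?_)
      ((memℓp_ofReal_iff (zero_lt_one.trans hp)).1 hf)
    refine Real.rpow_le_rpow (abs_nonneg _) ?_ (zero_lt_one.trans hp).le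
    simpa using norm_indicator_le_norm_self f n
  -- As p < ∞, f·χ_A is the sum in ℓ^p of its coordinates, and S preserves this sum.
  refine (((lp.hasSum_single ENNReal.ofReal_ne_top
    (⟨_, hfA⟩ : lp (fun _ : ℕ => ℝ) (ENNReal.ofReal p))).mapL S).summable).congr fun n => ?_
  rw [← hSe, ← map_smul, ← lp.single_smul, smul_eq_mul, mul_one]

theorem ellSet_one_subset_of_ellSet_subset_L1 {T : Ell1 →L[ℝ] E} {p : ℝ} (hp : 1 < p)
    (h : ellSet p ⊆ (assocMeasure T).L1) :
    ellSet 1 ⊆ (assocMeasure T).LPow (1 / p) ∩ (assocMeasure T).L1 := by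
  have hp0 : 0 < p := zero_lt_one.trans hp
  refine fun f hf => ⟨⟨measurable_finiteSets_loc f, h ?_⟩,
    h (hf.of_exponent_ge (ENNReal.ofReal_le_ofReal hp.le))⟩
  refine (memℓp_ofReal_iff hp0).2 (((memℓp_ofReal_iff one_pos).1 hf).congr fun n => ?_)
  rw [abs_of_nonneg (Real.rpow_nonneg (abs_nonneg (f n)) _), ← Real.rpow_mul (abs_nonneg _),
    one_div, inv_mul_cancel₀ hp0.ne']

theorem exists_sum_bound_of_ellSet_one_subset {T : Ell1 →L[ℝ] E} {p : ℝ} (hp : 1 < p)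
    (h : ellSet 1 ⊆ (assocMeasure T).LPow (1 / p)) :
    ∃ C : ℝ, 0 < C ∧ ∀ (M : Finset ℕ) (x : ℕ → ℝ), (∀ j ∈ M, 0 ≤ x j) →
      ‖∑ j ∈ M, x j • T (Ell1.e j)‖ ≤ C * (∑ j ∈ M, x j ^ p) ^ (1 / p) := by
  have hp0 : 0 < p := zero_lt_one.trans hp
  have : Fact ((1 : ℝ≥0∞) ≤ ENNReal.ofReal p) := ⟨ENNReal.one_le_ofReal.2 hp.le⟩
  have hq : (ENNReal.ofReal p).toReal = p := ENNReal.toReal_ofReal hp0.le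
  obtain ⟨C, hC⟩ := lp.exists_bound_of_weakly_summable (q := ENNReal.ofReal p)
    (v := fun n => T (Ell1.e n)) fun f x => by
      -- The hypothesis is applied to |f|^p, whose power 1/p is |f|.
      have hf : (fun n => |f n| ^ p) ∈ ellSet 1 := by
        refine (memℓp_ofReal_iff one_pos).2
          (((memℓp_ofReal_iff hp0).1 (lp.memℓp f)).congr fun n => ?_)
        rw [Real.rpow_one, abs_of_nonneg (Real.rpow_nonneg (abs_nonneg (f n)) p)]
      refine (summable_of_mem_L1_assocMeasure (h hf).2 x).congr fun n => ?_
      have hn : |(|(|f n| ^ p)| ^ (1 / p))| = |f n| := by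
        rw [abs_of_nonneg (by positivity), abs_of_nonneg (by positivity), one_div,
          Real.rpow_rpow_inv (abs_nonneg _) hp0.ne']
      rw [hn]
  -- Uniform boundedness gives no sign for C; the maximum with 1 makes it positive.
  refine ⟨max C 1, by positivity, fun M x hx => ?_⟩
  let g : lp (fun _ : ℕ => ℝ) (ENNReal.ofReal p) := ∑ j ∈ M, lp.single _ j (x j)
  have hg : ∀ j ∈ M, g j = x j := fun j hj => by
    simp only [g, lp.coeFn_sum, Finset.sum_apply, lp.single_apply, Finset.sum_pi_single, if_pos hj]
  have hnorm : ‖g‖ = (∑ j ∈ M, x j ^ p) ^ (1 / p) := by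
    have h1 := lp.norm_sum_single (E := fun _ : ℕ => ℝ) (p := ENNReal.ofReal p)
      (by rwa [hq]) x M
    rw [hq] at h1
    rw [one_div, ← Real.rpow_rpow_inv (norm_nonneg g) hp0.ne', h1]
    congr 1
    exact Finset.sum_congr rfl fun j hj => by rw [Real.norm_of_nonneg (hx j hj)]
  have hsum : ∑ j ∈ M, x j • T (Ell1.e j) = ∑ j ∈ M, g j • T (Ell1.e j) :=
    Finset.sum_congr rfl fun j hj => by rw [hg j hj]
  rw [← hnorm, hsum]
  exact (hC M g).trans (mul_le_mul_of_nonneg_right (le_max_left _ _) (norm_nonneg g))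

theorem extendsToEll_of_sum_bound [CompleteSpace E] {T : Ell1 →L[ℝ] E} {p : ℝ} (hp : 1 < p)
    {C : ℝ} (hC : 0 ≤ C)
    (h : ∀ (M : Finset ℕ) (x : ℕ → ℝ), (∀ j ∈ M, 0 ≤ x j) →
      ‖∑ j ∈ M, x j • T (Ell1.e j)‖ ≤ C * (∑ j ∈ M, x j ^ p) ^ (1 / p)) :
    ExtendsToEll T p hp := by
  have hp0 : 0 < p := zero_lt_one.trans hp
  have : Fact ((1 : ℝ≥0∞) ≤ ENNReal.ofReal p) := ⟨ENNReal.one_le_ofReal.2 hp.le⟩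
  obtain ⟨S, hS⟩ := lp.exists_continuousLinearMap_of_sum_bound (q := ENNReal.ofReal p)
    ENNReal.ofReal_ne_top (v := fun n => T (Ell1.e n)) (mul_nonneg zero_le_two hC) (by
      rw [ENNReal.toReal_ofReal hp0.le]
      exact norm_sum_smul_le_two_mul_of_nonneg hp0 hC h)
  -- For x in ℓ¹, T x is the sum of the same series, since x is the sum of its coordinates in ℓ¹.
  refine ⟨S, fun x => (hS _).unique ?_⟩
  refine ((lp.hasSum_single ENNReal.one_ne_top x).mapL T).congr_fun fun n => ?_
  rw [Ell1.e_eq_single, ← map_smul, ← lp.single_smul, smul_eq_mul, mul_one]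

end AssociatedMeasure

theorem mainTheorem7 {E : Type*} [NormedAddCommGroup E] [NormedSpace ℝ E] [CompleteSpace E]
    (T : Ell1 →L[ℝ] E) (hT : ∀ n, T (Ell1.e n) ≠ 0) (p : ℝ) (hp : 1 < p) :
    List.TFAE [
      ExtendsToEll T p hp,
      ellSet p ⊆ (assocMeasure T).L1,
      ellSet 1 ⊆ (assocMeasure T).LPow (1 / p) ∩ (assocMeasure T).L1,
      ∃ C : ℝ, 0 < C ∧ ∀ (M : Finset ℕ) (x : ℕ → ℝ), (∀ j ∈ M, 0 ≤ x j) →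
        ‖∑ j ∈ M, x j • T (Ell1.e j)‖ ≤ C * (∑ j ∈ M, x j ^ p) ^ (1 / p)] := by
  tfae_have 1 → 2 := ellSet_subset_L1_of_extendsToEll
  tfae_have 2 → 3 := ellSet_one_subset_of_ellSet_subset_L1 hp
  tfae_have 3 → 4 := fun h =>
    exists_sum_bound_of_ellSet_one_subset hp (h.trans Set.inter_subset_left)
  tfae_have 4 → 1 := fun ⟨_, hC, h⟩ => extendsToEll_of_sum_bound hp hC.le h
  tfae_finish
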